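/- **Setting.** Let $H$ be a separable real Hilbert space, and let $(X,Y)$ be a random pair with values in $H\times\mathbb R$ such that $\mathbb E\|X\|^4<\infty$, $\mathbb E X=0$, $\mathbb E Y^2<\infty$. Let $\Gamma h=\mathbb E(\langle h,X\rangle X)$ be the covariance operator of $X$. Assume that $\ker\Gamma=\{0\}$ and that the nonzero eigenvalues of $\Gamma$ form an infinite sequence $\lambda_1>\lambda_2>\dots>0$ (so $\dim H=\infty$), each of multiplicity one, with orthonormal eigenvectors $e_1,e_2,\dots$. Let $\rho\in H$ and $\sigma_\varepsilon>0$ be such that $\varepsilon=Y-\langle\rho,X\rangle$ satisfies $\mathbb E(\varepsilon\mid X)=0$ and $\mathbb E(\varepsilon^2\mid X)=\sigma_\varepsilon^2$. Let $(X_i,Y_i)_{i\ge1}$ be independent copies of $(X,Y)$. **Estimator.** Let $c_n\in(0,\lambda_1)$ with $c_n\to0$, and let $f_n:\mathbb R\to[0,\infty)$ be positive on $[c_n,\infty)$ and zero on $(-\infty,c_n)$, decreasing (not necessarily strictly) on $[c_n,\lambda_1+(\lambda_1-\lambda_2)]$, differentiable on $[c_n,\infty)$ (one-sidedly at $c_n$),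 with $\sup_{x\ge c_n}|xf_n(x)-1|\to0$ and, moreover, $\sup_{x\ge c_n}|xf_n(x)-1|=o(1/\sqrt n)$ as $n\to\infty$. Put $$\Gamma_n=\frac1n\sum_{i=1}^n\langle X_i,\cdot\rangle X_i,\qquad \Delta_n=\frac1n\sum_{i=1}^nY_iX_i\in H,\qquad \Gamma_n^\dagger=f_n(\Gamma_n),\qquad \widehat\rho_n=\Gamma_n^\dagger\Delta_n,$$ where $f_n(\Gamma_n)$ is the finite-rank operator with the eigenvectors of $\Gamma_n$ and eigenvalues $f_n(\widehat\lambda_j)$, the $\widehat\lambda_j$ being the eigenvalues of $\Gamma_n$. **Theorem 1.** Let $(\alpha_n)$ be any deterministic sequence of real numbers (for instance $\alpha_n\equiv1$, or any $\alpha_n\to+\infty$). If $\alpha_n(\widehat\rho_n-\rho)$ converges in distribution, for the norm topology of $H$, to a random element $Z$ of $H$, then $Z$ is degenerate, i.e. almost surely equal to a constant element of $H$. In particular, $\widehat\rho_n-\rho$ cannot converge in distribution in the norm topology of $H$, under any normalization, to a non-degenerate random element, so no central limit theorem for the coefficient $\rho$ is possible in the norm topology. -/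

import Mathlib

open MeasureTheory ProbabilityTheory Filter Topology
open scoped RealInnerProductSpace ENNReal

/-- The functional linear regression model `Y = ⟪ρ, X⟫ + ε`, where the error `ε = Y - ⟪ρ, X⟫`
satisfies `𝔼(ε | X) = 0` and `𝔼(ε² | X) = σ²`; the predictor `X` is centered with `𝔼‖X‖⁴ < ∞`,
its covariance operator has trivial kernel, and `𝔼 Y² < ∞`. -/
structure IsFunctionalLinearModel {Ω H : Type*} [MeasurableSpace Ω]
    [NormedAddCommGroup H] [InnerProductSpace ℝ H] [CompleteSpace H]
    [MeasurableSpace H] [BorelSpace H]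
    (P : Measure Ω) (X : Ω → H) (Y : Ω → ℝ) (ρ : H) (σ : ℝ) : Prop where
  measurable_X : Measurable X
  measurable_Y : Measurable Y
  memLp_X : MemLp X 4 P
  memLp_Y : MemLp Y 2 P
  mean_X : ∫ ω, X ω ∂P = 0
  ker_cov : ∀ h : H, covarianceOperator (P.map X) h = 0 → h = 0
  condExp_error :
    P[fun ω => Y ω - ⟪ρ, X ω⟫ | MeasurableSpace.comap X inferInstance] =ᵐ[P] fun _ => 0
  condExp_error_sq :
    P[fun ω => (Y ω - ⟪ρ, X ω⟫) ^ 2 | MeasurableSpace.comap X inferInstance]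
      =ᵐ[P] fun _ => σ ^ 2

/-- `(Xs i, Ys i)`, `i = 0, 1, 2, …`, are independent copies of the pair `(X, Y)`. -/
structure IsIIDSample {Ω H : Type*} [MeasurableSpace Ω] [MeasurableSpace H]
    (P : Measure Ω) (X : Ω → H) (Y : Ω → ℝ) (Xs : ℕ → Ω → H) (Ys : ℕ → Ω → ℝ) : Prop where
  measurable_X : ∀ i, Measurable (Xs i)
  measurable_Y : ∀ i, Measurable (Ys i)
  indep : iIndepFun (fun i ω => (Xs i ω, Ys i ω)) P
  identDistrib : ∀ i, IdentDistrib (fun ω => (Xs i ω, Ys i ω)) (fun ω => (X ω, Y ω)) P P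

/-- `lam 0 > lam 1 > … > 0` is the list of all nonzero eigenvalues of `T`, each of multiplicity
one, and `e 0, e 1, …` are orthonormal associated eigenvectors. -/
structure IsSimpleSpectrum {H : Type*} [NormedAddCommGroup H] [InnerProductSpace ℝ H]
    (T : H →L[ℝ] H) (lam : ℕ → ℝ) (e : ℕ → H) : Prop where
  strictAnti : StrictAnti lam
  pos : ∀ j, 0 < lam j
  orthonormal : Orthonormal ℝ e
  eigen : ∀ j, T (e j) = lam j • e j
  exhaust : ∀ (μ : ℝ) (v : H), μ ≠ 0 → v ≠ 0 → T v = μ • v →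
    ∃ j, μ = lam j ∧ v ∈ Submodule.span ℝ {e j}

/-- The thresholds `c n` and regularizing functions `f n`. Here `lam1 > lam2` are the two largest
eigenvalues of the covariance operator, so that `lam1 - lam2` is its first spectral gap. -/
structure IsRegularization (lam1 lam2 : ℝ) (c : ℕ → ℝ) (f : ℕ → ℝ → ℝ) : Prop where
  threshold_pos : ∀ n, 0 < c n
  threshold_lt : ∀ n, c n < lam1
  threshold_tendsto : Tendsto c atTop (𝓝 0)
  pos : ∀ n x, c n ≤ x → 0 < f n x
  eq_zero : ∀ n x, x < c n → f n x = 0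
  antitone : ∀ n, AntitoneOn (f n) (Set.Icc (c n) (lam1 + (lam1 - lam2)))
  differentiable : ∀ n, DifferentiableOn ℝ (f n) (Set.Ici (c n))
  /-- `sup_{x ≥ c n} |x f_n(x) - 1| → 0` -/
  approx : ∀ η > 0, ∀ᶠ n in atTop, ∀ x, c n ≤ x → |x * f n x - 1| ≤ η
  /-- `sup_{x ≥ c n} |x f_n(x) - 1| = o(1/√n)` -/
  approx_rate : ∀ η > 0, ∀ᶠ n : ℕ in atTop, ∀ x, c n ≤ x → √(n : ℝ) * |x * f n x - 1| ≤ η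

section Estimator

variable {H : Type*} [NormedAddCommGroup H] [InnerProductSpace ℝ H]

/-- The empirical covariance operator `Γ_n = n⁻¹ ∑_{i < n} x_i ⊗ x_i`, `(x ⊗ x) h = ⟪x, h⟫ x`. -/
noncomputable def empCov (x : ℕ → H) (n : ℕ) : H →L[ℝ] H :=
  (n : ℝ)⁻¹ • ∑ i ∈ Finset.range n, InnerProductSpace.rankOne ℝ (x i) (x i)

/-- The empirical cross-covariance `Δ_n = n⁻¹ ∑_{i < n} y_i x_i`, the element of `H` representing
the functional `h ↦ n⁻¹ ∑_{i < n} ⟪h, x_i⟫ y_i`. -/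
noncomputable def empCrossCov (x : ℕ → H) (y : ℕ → ℝ) (n : ℕ) : H :=
  (n : ℝ)⁻¹ • ∑ i ∈ Finset.range n, y i • x i

/-- `g(T) = ∑_μ g(μ) P_μ` for a self-adjoint operator `T` of finite rank: the sum runs over the
(finitely many) eigenvalues `μ` of `T`, and `P_μ` is the orthogonal projection onto the eigenspace
`ker (T - μ)`, which is zero if `μ` is not an eigenvalue. -/
noncomputable def spectralFun [CompleteSpace H] (g : ℝ → ℝ) (T : H →L[ℝ] H) : H →L[ℝ] H :=
  ∑ᶠ μ : ℝ, g μ • (T - μ • ContinuousLinearMap.id ℝ H).ker.starProjection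

/-- The regularized estimator `ρ̂ = Γ_n† Δ_n`, `Γ_n† = f_n(Γ_n)`, where `g = f_n`. -/
noncomputable def regEstimator [CompleteSpace H] (g : ℝ → ℝ) (x : ℕ → H) (y : ℕ → ℝ) (n : ℕ) : H :=
  spectralFun g (empCov x n) (empCrossCov x y n)

end Estimator

/-! The error of the estimator is tested against the random vectors `Γ_n e_j` instead of `e_j`.
Write `Δ_n = Γ_n ρ + U_n` with noise `U_n = n⁻¹ ∑ ε_i X_i`. The operator `f_n(Γ_n) Γ_n` is almost
the spectral projection of `Γ_n` on `[c_n, ∞)`, however large `f_n` is, and `e_j` is almost in its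
range because `λ_j > c_n` eventually. This gives `⟪ρ̂_n - ρ, Γ_n e_j⟫ = ⟪U_n, e_j⟫ + o_P(n^{-1/2})`
(`abs_inner_sub_le`, `tendstoInMeasure_sqrt_mul_inner_regEstimator_sub`), while `√n ⟪U_n, e_j⟫`
tends in law to `N(0, σ² λ_j)`.

Suppose `α_n (ρ̂_n - ρ)` tends in law to `Z`. By Slutsky, its inner product with `Γ_n e_j` tends in
law to `λ_j ⟪Z, e_j⟫`. Put `β_n = α_n / √n`. If `|β_n| → ∞`, dividing by `β_n` forces `N(0, σ² λ_0)`
to be a point mass, which is absurd. Otherwise `β_n → b` along a subsequence, and `⟪Z, e_j⟫` has law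
`N(0, b² σ² / λ_j)`. These variances are bounded below when `b ≠ 0`, although `⟪Z, e_j⟫ → 0` by
Bessel (`not_forall_map_inner_eq_gaussianReal`). Hence `b = 0`, every coordinate of `Z` vanishes,
and `Z = 0` almost surely. -/

section Spectral

/-! ### Finite spectral calculus and perturbation of regularized inverses. -/

variable {H : Type*} [NormedAddCommGroup H] [InnerProductSpace ℝ H]

/-- A finite spectral resolution of `T`: mutually orthogonal symmetric maps `Q μ`, `μ ∈ s`, summing
to the identity and satisfying `T ∘ Q μ = Q μ ∘ T = μ • Q μ`. -/
structure IsSpectralResolution (T : H →L[ℝ] H) (s : Finset ℝ) (Q : ℝ → H →L[ℝ] H) : Prop where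
  symm : ∀ μ v w, ⟪Q μ v, w⟫ = ⟪v, Q μ w⟫
  ortho : ∀ μ ν v w, μ ≠ ν → ⟪Q μ v, Q ν w⟫ = 0
  sum_eq : ∀ v, ∑ μ ∈ s, Q μ v = v
  apply_left : ∀ μ v, T (Q μ v) = μ • Q μ v
  apply_right : ∀ μ v, Q μ (T v) = μ • Q μ v

namespace IsSpectralResolution

variable {T : H →L[ℝ] H} {s : Finset ℝ} {Q : ℝ → H →L[ℝ] H}

theorem norm_sum_sq (h : IsSpectralResolution T s Q) (a : ℝ → ℝ) (v : H) :
    ‖∑ μ ∈ s, a μ • Q μ v‖ ^ 2 = ∑ μ ∈ s, a μ ^ 2 * ‖Q μ v‖ ^ 2 := by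
  rw [← real_inner_self_eq_norm_sq, sum_inner]
  refine Finset.sum_congr rfl fun μ hμ => ?_
  rw [inner_sum, Finset.sum_eq_single_of_mem μ hμ]
  · rw [real_inner_smul_left, real_inner_smul_right, real_inner_self_eq_norm_sq]; ring
  · intro ν _ hν
    rw [real_inner_smul_left, real_inner_smul_right, h.ortho _ _ _ _ hν.symm]; simp

/-- By Pythagoras, pointwise domination of multipliers on the spectrum becomes domination of norms;
all operator bounds below come from this. -/
theorem norm_sum_le (h : IsSpectralResolution T s Q) {a b : ℝ → ℝ} {M : ℝ} (hM : 0 ≤ M)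
    (hab : ∀ μ ∈ s, |a μ| ≤ M * |b μ|) (v : H) :
    ‖∑ μ ∈ s, a μ • Q μ v‖ ≤ M * ‖∑ μ ∈ s, b μ • Q μ v‖ := by
  refine le_of_sq_le_sq ?_ (by positivity)
  rw [mul_pow, h.norm_sum_sq, h.norm_sum_sq, Finset.mul_sum]
  refine Finset.sum_le_sum fun μ hμ => ?_
  rw [← mul_assoc]
  gcongr
  rw [← sq_abs (a μ), ← sq_abs (b μ), ← mul_pow]
  gcongr
  exact hab μ hμ

theorem norm_sum_le_norm (h : IsSpectralResolution T s Q) {a : ℝ → ℝ} {M : ℝ} (hM : 0 ≤ M)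
    (ha : ∀ μ ∈ s, |a μ| ≤ M) (v : H) : ‖∑ μ ∈ s, a μ • Q μ v‖ ≤ M * ‖v‖ := by
  simpa [h.sum_eq] using h.norm_sum_le (b := fun _ => 1) hM (by simpa using ha) v

theorem apply_sum (h : IsSpectralResolution T s Q) (a : ℝ → ℝ) (v : H) :
    T (∑ μ ∈ s, a μ • Q μ v) = ∑ μ ∈ s, (μ * a μ) • Q μ v := by
  rw [map_sum]
  refine Finset.sum_congr rfl fun μ _ => ?_
  rw [map_smul, h.apply_left, smul_smul, mul_comm]

theorem sum_apply (h : IsSpectralResolution T s Q) (a : ℝ → ℝ) (v : H) :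
    ∑ μ ∈ s, a μ • Q μ (T v) = ∑ μ ∈ s, (μ * a μ) • Q μ v := by
  refine Finset.sum_congr rfl fun μ _ => ?_
  rw [h.apply_right, smul_smul, mul_comm]

theorem inner_sum_left (h : IsSpectralResolution T s Q) (a : ℝ → ℝ) (v w : H) :
    ⟪∑ μ ∈ s, a μ • Q μ v, w⟫ = ⟪v, ∑ μ ∈ s, a μ • Q μ w⟫ := by
  rw [sum_inner, inner_sum]
  refine Finset.sum_congr rfl fun μ _ => ?_
  rw [real_inner_smul_left, real_inner_smul_right, h.symm]

/-- The component of an eigenvector `e` of a nearby operator `G` on the part of the spectrum of `T`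
below the threshold `c`. -/
theorem norm_sum_lt_le (h : IsSpectralResolution T s Q) (hs : ∀ μ ∈ s, 0 ≤ μ) {c l : ℝ}
    (hc : 0 < c) (hcl : c < l) (G : H →L[ℝ] H) {e : H} (he : G e = l • e) :
    ‖∑ μ ∈ s, (if μ < c then (1 : ℝ) else 0) • Q μ e‖ ≤ ‖(G - T) e‖ / (l - c) := by
  set χ : ℝ → ℝ := fun μ => if μ < c then 1 else 0 with hχ
  change ‖∑ μ ∈ s, χ μ • Q μ e‖ ≤ _
  -- With `w = χ(T) e`, apply `χ(T)` to `l e = (G - T) e + T e` and commute it past `T`. Since `‖T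
  -- w‖ ≤ c ‖w‖`, this yields `(l - c) ‖w‖ ≤ ‖(G - T) e‖`.
  have h1 : l • ∑ μ ∈ s, χ μ • Q μ e
      = ∑ μ ∈ s, χ μ • Q μ ((G - T) e) + T (∑ μ ∈ s, χ μ • Q μ e) := by
    rw [h.apply_sum, ← h.sum_apply, ← Finset.sum_add_distrib, Finset.smul_sum]
    refine Finset.sum_congr rfl fun μ _ => ?_
    rw [sub_apply, map_sub, he, map_smul, smul_sub, sub_add_cancel, smul_comm]
  have h2 : ‖∑ μ ∈ s, χ μ • Q μ ((G - T) e)‖ ≤ 1 * ‖(G - T) e‖ := by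
    refine h.norm_sum_le_norm zero_le_one (fun μ _ => ?_) _
    simp only [hχ]; split_ifs <;> simp
  have h3 : ‖T (∑ μ ∈ s, χ μ • Q μ e)‖ ≤ c * ‖∑ μ ∈ s, χ μ • Q μ e‖ := by
    rw [h.apply_sum]
    refine h.norm_sum_le hc.le (fun μ hμ => ?_) _
    simp only [hχ]; split_ifs with hlt
    · simpa [abs_of_nonneg (hs μ hμ)] using hlt.le
    · simp
  have h4 : l * ‖∑ μ ∈ s, χ μ • Q μ e‖ ≤ ‖(G - T) e‖ + c * ‖∑ μ ∈ s, χ μ • Q μ e‖ := by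
    have : ‖l • ∑ μ ∈ s, χ μ • Q μ e‖ = l * ‖∑ μ ∈ s, χ μ • Q μ e‖ := by
      rw [norm_smul, Real.norm_of_nonneg (hc.trans hcl).le]
    rw [← this, h1]
    refine (norm_add_le _ _).trans ?_
    linarith
  rw [le_div_iff₀ (by linarith)]
  linarith

/-- Perturbation bound for a regularized inverse `F = g(T)`: tested against `T e`, where `e` is a
unit eigenvector of a nearby operator `G`, the vector `F (T ρ + u) - ρ` is close to `⟪u, e⟫`. -/
theorem abs_inner_sub_le (h : IsSpectralResolution T s Q) (hs : ∀ μ ∈ s, 0 ≤ μ)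
    {c l η : ℝ} (hc : 0 < c) (hcl : c < l) (hη : 0 ≤ η) (g : ℝ → ℝ) (hg0 : ∀ x < c, g x = 0)
    (hg : ∀ x, c ≤ x → |x * g x - 1| ≤ η) (F : H →L[ℝ] H)
    (hF : ∀ v, F v = ∑ μ ∈ s, g μ • Q μ v)
    (G : H →L[ℝ] H) {e : H} (he : G e = l • e) (he1 : ‖e‖ = 1) (ρ u : H) :
    |⟪F (T ρ + u) - ρ, T e⟫ - ⟪u, e⟫|
      ≤ ‖ρ‖ * (η * ‖T‖ + c * (‖(G - T) e‖ / (l - c))) + ‖u‖ * (η + ‖(G - T) e‖ / (l - c)) := by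
  set χ : ℝ → ℝ := fun μ => if μ < c then 1 else 0 with hχ
  set a : ℝ → ℝ := fun μ => if μ < c then 0 else μ * g μ - 1 with ha
  set w := ∑ μ ∈ s, χ μ • Q μ e with hw
  set z := ∑ μ ∈ s, a μ • Q μ e with hz
  have hwle : ‖w‖ ≤ ‖(G - T) e‖ / (l - c) := h.norm_sum_lt_le hs hc hcl G he
  have hzle : ‖z‖ ≤ η := by
    have := h.norm_sum_le_norm (a := a) hη (fun μ _ => ?_) e
    · simpa [he1] using this
    · simp only [ha]; split_ifs with hlt
      · simpa using hη
      · exact hg μ (not_lt.1 hlt)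
  -- The extra factor `c` is what makes the truncation bias negligible: `‖w‖` alone is only of order
  -- `n^{-1/2}`.
  have hTw : ‖T w‖ ≤ c * ‖w‖ := by
    rw [hw, h.apply_sum]
    refine h.norm_sum_le hc.le (fun μ hμ => ?_) _
    simp only [hχ]; split_ifs with hlt
    · simpa [abs_of_nonneg (hs μ hμ)] using hlt.le
    · simp
  have hTz : ‖T z‖ ≤ ‖T‖ * η := (T.le_opNorm z).trans (by gcongr)
  -- The multiplier `μ g(μ)` is `0` below `c` and `1 + a(μ)` above it, that is `1 + a(μ) - χ(μ)`
  -- everywhere.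
  have hFT : F (T e) = e + (z - w) := by
    rw [hF, h.sum_apply, hz, hw, ← Finset.sum_sub_distrib]
    nth_rw 2 [← h.sum_eq e]
    rw [← Finset.sum_add_distrib]
    refine Finset.sum_congr rfl fun μ _ => ?_
    simp only [ha, hχ]
    split_ifs with hlt
    · simp [hg0 μ hlt]
    · simp [sub_smul]
  have hTsymm : ∀ v v', ⟪T v, v'⟫ = ⟪v, T v'⟫ := fun v v' => by
    have h1 : ∀ v, T v = ∑ μ ∈ s, μ • Q μ v := fun v => by
      rw [← h.sum_eq (T v)]; exact Finset.sum_congr rfl fun μ _ => h.apply_right μ v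
    rw [h1, h1, h.inner_sum_left (fun μ => μ)]
  have hkey : ⟪F (T ρ + u) - ρ, T e⟫ - ⟪u, e⟫ = ⟪ρ, T z⟫ - ⟪ρ, T w⟫ + ⟪u, z - w⟫ := by
    have h1 : ⟪F (T ρ + u), T e⟫ = ⟪T ρ + u, F (T e)⟫ := by
      rw [hF, hF, h.inner_sum_left]
    rw [inner_sub_left, h1, hFT, inner_add_left, hTsymm, map_add, map_sub, inner_add_right,
      inner_sub_right, inner_add_right]
    ring
  rw [hkey]
  calc |⟪ρ, T z⟫ - ⟪ρ, T w⟫ + ⟪u, z - w⟫|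
      ≤ |⟪ρ, T z⟫| + |⟪ρ, T w⟫| + |⟪u, z - w⟫| :=
        (abs_add_le _ _).trans (add_le_add (abs_sub _ _) le_rfl)
    _ ≤ ‖ρ‖ * ‖T z‖ + ‖ρ‖ * ‖T w‖ + ‖u‖ * ‖z - w‖ := by
        gcongr <;> exact abs_real_inner_le_norm _ _
    _ ≤ ‖ρ‖ * (‖T‖ * η) + ‖ρ‖ * (c * ‖w‖) + ‖u‖ * (‖z‖ + ‖w‖) := by
        gcongr
        exact norm_sub_le _ _
    _ ≤ ‖ρ‖ * (‖T‖ * η) + ‖ρ‖ * (c * (‖(G - T) e‖ / (l - c)))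
        + ‖u‖ * (η + ‖(G - T) e‖ / (l - c)) := by gcongr
    _ = _ := by ring

end IsSpectralResolution

/-- Eigenvectors for distinct nonzero eigenvalues are linearly independent and lie in the range,
which is finite-dimensional. -/
theorem ContinuousLinearMap.finite_setOf_eigenvalue_ne_zero (T : H →L[ℝ] H)
    [FiniteDimensional ℝ T.range] :
    {μ : ℝ | μ ≠ 0 ∧ (T - μ • ContinuousLinearMap.id ℝ H).ker ≠ ⊥}.Finite := by
  set S := {μ : ℝ | μ ≠ 0 ∧ (T - μ • ContinuousLinearMap.id ℝ H).ker ≠ ⊥}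
  have hex : ∀ μ : S, ∃ v : H, T v = (μ : ℝ) • v ∧ v ≠ 0 := by
    rintro ⟨μ, _, hμ⟩
    obtain ⟨v, hv, hv0⟩ := Submodule.exists_mem_ne_zero_of_ne_bot hμ
    refine ⟨v, ?_, hv0⟩
    simpa [sub_eq_zero] using hv
  choose x hx hx0 using hex
  have hli : LinearIndependent ℝ x :=
    Module.End.eigenvectors_linearIndependent (T : Module.End ℝ H) S x fun μ =>
      ⟨Module.End.mem_eigenspace_iff.2 (hx μ), hx0 μ⟩
  have hmem : ∀ μ, x μ ∈ T.range := fun μ =>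
    ⟨(μ : ℝ)⁻¹ • x μ, by simp [hx, smul_smul, inv_mul_cancel₀ μ.2.1]⟩
  have hli' : LinearIndependent ℝ (fun μ : S => (⟨x μ, hmem μ⟩ : T.range)) :=
    LinearIndependent.of_comp T.range.subtype hli
  have := hli'.finite
  exact S.toFinite

/-- The spectral theorem for compact self-adjoint operators, with finitely many eigenspaces because
the range is finite-dimensional. It also turns the `finsum` in `spectralFun` into an honest finite
sum. -/
theorem exists_isSpectralResolution [CompleteSpace H] {T : H →L[ℝ] H} (hT : IsCompactOperator T)
    (hsymm : (T : H →ₗ[ℝ] H).IsSymmetric) [FiniteDimensional ℝ T.range] :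
    ∃ s : Finset ℝ, IsSpectralResolution T s
        (fun μ => (T - μ • ContinuousLinearMap.id ℝ H).ker.starProjection) ∧
      (∀ μ ∈ s, μ ≠ 0 → ∃ v : H, v ≠ 0 ∧ T v = μ • v) ∧
      ∀ (g : ℝ → ℝ) (v : H), spectralFun g T v =
        ∑ μ ∈ s, g μ • (T - μ • ContinuousLinearMap.id ℝ H).ker.starProjection v := by
  have hfin := T.finite_setOf_eigenvalue_ne_zero
  set E : ℝ → Submodule ℝ H := fun μ => (T - μ • ContinuousLinearMap.id ℝ H).ker with hE
  have hmemE : ∀ μ v, v ∈ E μ ↔ T v = μ • v := fun μ v => by simp [hE, sub_eq_zero]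
  have hEeig : ∀ μ, E μ = Module.End.eigenspace (T : Module.End ℝ H) μ := fun μ => by
    ext v; rw [hmemE, Module.End.mem_eigenspace_iff]; rfl
  have hTP : ∀ μ v, T ((E μ).starProjection v) = μ • (E μ).starProjection v := fun μ v =>
    (hmemE μ _).1 (Submodule.starProjection_apply_mem _ _)
  have hPsymm : ∀ μ v w, ⟪(E μ).starProjection v, w⟫ = ⟪v, (E μ).starProjection w⟫ :=
    fun μ v w => Submodule.inner_starProjection_left_eq_right _ _ _
  have hsymm' : ∀ v w, ⟪T v, w⟫ = ⟪v, T w⟫ := hsymm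
  have horth : ∀ μ ν v w, μ ≠ ν → v ∈ E μ → w ∈ E ν → ⟪v, w⟫ = 0 := by
    intro μ ν v w hne hv hw
    have := hsymm' v w
    rw [(hmemE _ _).1 hv, (hmemE _ _).1 hw, real_inner_smul_left, real_inner_smul_right] at this
    have h2 : (μ - ν) * ⟪v, w⟫ = 0 := by linarith
    exact (mul_eq_zero.1 h2).resolve_left (sub_ne_zero.2 hne)
  have hzero : ∀ μ, E μ = ⊥ → (E μ).starProjection = 0 := fun μ h => by
    ext v
    have : (E μ).starProjection v ∈ E μ := Submodule.starProjection_apply_mem _ _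
    exact (Submodule.mem_bot ℝ).1 (h.le this)
  -- The value `0` is added so that the projection on the kernel is counted; without it the
  -- projections would not sum to the identity.
  set s : Finset ℝ := insert 0 hfin.toFinset with hs
  have hnot : ∀ μ, μ ∉ s → E μ = ⊥ := fun μ hμ => by
    by_contra hb
    simp only [hs, Finset.mem_insert, Set.Finite.mem_toFinset, not_or] at hμ
    exact hμ.2 ⟨hμ.1, hb⟩
  refine ⟨s, ⟨hPsymm, ?_, ?_, hTP, ?_⟩, ?_, ?_⟩
  · exact fun μ ν v w hne => horth μ ν _ _ hne (Submodule.starProjection_apply_mem _ _)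
      (Submodule.starProjection_apply_mem _ _)
  · intro v
    set u := v - ∑ μ ∈ s, (E μ).starProjection v with hu
    have hperp : u ∈ (⨆ μ, Module.End.eigenspace (T : Module.End ℝ H) μ)ᗮ := by
      rw [← Submodule.iInf_orthogonal, Submodule.mem_iInf]
      intro ν
      rw [← hEeig, Submodule.mem_orthogonal]
      intro w hw
      by_cases hν : ν ∈ s
      · rw [hu, inner_sub_right, inner_sum, Finset.sum_eq_single_of_mem ν hν, ← hPsymm,
          Submodule.starProjection_eq_self_iff.2 hw, sub_self]
        intro μ _ hμ
        exact horth ν μ _ _ hμ.symm hw (Submodule.starProjection_apply_mem _ _)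
      · have := hnot ν hν
        rw [this, Submodule.mem_bot] at hw
        simp [hw]
    rw [ContinuousLinearMap.orthogonalComplement_iSup_eigenspaces_eq_bot hT hsymm,
      Submodule.mem_bot] at hperp
    exact (sub_eq_zero.1 hperp).symm
  · intro μ v
    refine ext_inner_right ℝ fun w => ?_
    rw [hPsymm, hsymm', hTP, real_inner_smul_right, real_inner_smul_left, hPsymm]
  · intro μ hμ hμ0
    simp only [hs, Finset.mem_insert, Set.Finite.mem_toFinset, hμ0, false_or] at hμ
    obtain ⟨v, hv, hv0⟩ := Submodule.exists_mem_ne_zero_of_ne_bot hμ.2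
    exact ⟨v, hv0, (hmemE μ v).1 hv⟩
  · intro g v
    rw [spectralFun, finsum_eq_sum_of_support_subset (s := s)]
    · simp
    · intro μ hμ
      by_contra hns
      refine hμ ?_
      change g μ • (E μ).starProjection = 0
      rw [hzero μ (hnot μ hns), smul_zero]

end Spectral

/-! ### The empirical covariance operator and the sampling noise. -/

section EmpiricalCovariance

variable {H : Type*} [NormedAddCommGroup H] [InnerProductSpace ℝ H]

theorem empCov_apply (x : ℕ → H) (n : ℕ) (v : H) :
    empCov x n v = (n : ℝ)⁻¹ • ∑ i ∈ Finset.range n, ⟪x i, v⟫ • x i := by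
  simp [empCov]

theorem norm_empCov_le (x : ℕ → H) (n : ℕ) :
    ‖empCov x n‖ ≤ (n : ℝ)⁻¹ * ∑ i ∈ Finset.range n, ‖x i‖ ^ 2 := by
  rw [empCov, norm_smul, norm_inv, RCLike.norm_natCast]
  gcongr
  refine (norm_sum_le _ _).trans (Finset.sum_le_sum fun i _ => ?_)
  rw [InnerProductSpace.norm_rankOne, sq]

theorem isSymmetric_empCov (x : ℕ → H) (n : ℕ) : (empCov x n : H →ₗ[ℝ] H).IsSymmetric := by
  intro v w
  simp only [ContinuousLinearMap.coe_coe, empCov_apply, real_inner_smul_left,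
    real_inner_smul_right, sum_inner, inner_sum]
  congr 1
  refine Finset.sum_congr rfl fun i _ => ?_
  rw [real_inner_comm w (x i), real_inner_comm v (x i)]; ring

theorem inner_empCov_self_nonneg (x : ℕ → H) (n : ℕ) (v : H) : 0 ≤ ⟪empCov x n v, v⟫ := by
  simp only [empCov_apply, real_inner_smul_left, sum_inner]
  exact mul_nonneg (by positivity) (Finset.sum_nonneg fun i _ => mul_self_nonneg _)

theorem isCompactOperator_empCov (x : ℕ → H) (n : ℕ) : IsCompactOperator (empCov x n) := by
  have h : ∀ i, IsCompactOperator (InnerProductSpace.rankOne ℝ (x i) (x i)) := fun i => by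
    have : IsCompactOperator (innerSL ℝ (x i)) :=
      isCompactOperator_of_locallyCompactSpace_dom _
    exact this.clm_comp (ContinuousLinearMap.toSpanSingleton ℝ (x i))
  exact ((compactOperator (RingHom.id ℝ) H H).smul_mem _
    (Submodule.sum_mem _ fun i _ => h i) : _ ∈ compactOperator (RingHom.id ℝ) H H)

instance finiteDimensional_range_empCov (x : ℕ → H) (n : ℕ) :
    FiniteDimensional ℝ (empCov x n).range := by
  classical
  refine Submodule.finiteDimensional_of_le
    (S₂ := Submodule.span ℝ (((Finset.range n).image x : Finset H) : Set H)) ?_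
  rintro _ ⟨v, rfl⟩
  rw [ContinuousLinearMap.coe_coe, empCov_apply]
  refine Submodule.smul_mem _ _ (Submodule.sum_mem _ fun i hi => Submodule.smul_mem _ _ ?_)
  exact Submodule.subset_span (by simpa using ⟨i, Finset.mem_range.1 hi, rfl⟩)

/-- The sampling noise `n⁻¹ ∑_{i < n} (y_i - ⟪ρ, x_i⟫) x_i`. -/
noncomputable def empNoise (ρ : H) (x : ℕ → H) (y : ℕ → ℝ) (n : ℕ) : H :=
  (n : ℝ)⁻¹ • ∑ i ∈ Finset.range n, (y i - ⟪ρ, x i⟫) • x i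

theorem empCrossCov_eq (ρ : H) (x : ℕ → H) (y : ℕ → ℝ) (n : ℕ) :
    empCrossCov x y n = empCov x n ρ + empNoise ρ x y n := by
  rw [empCrossCov, empCov_apply, empNoise, ← smul_add, ← Finset.sum_add_distrib]
  congr 1
  refine Finset.sum_congr rfl fun i _ => ?_
  rw [← add_smul, real_inner_comm]; congr 1; ring

/-- The perturbation bound with `T = Γ_n` and `u = U_n`; positivity of `Γ_n` makes its eigenvalues
nonnegative. -/
theorem abs_inner_regEstimator_sub_le [CompleteSpace H] (x : ℕ → H) (y : ℕ → ℝ) (n : ℕ)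
    {c l η : ℝ} (hc : 0 < c) (hcl : c < l) (hη : 0 ≤ η) (g : ℝ → ℝ) (hg0 : ∀ x < c, g x = 0)
    (hg : ∀ x, c ≤ x → |x * g x - 1| ≤ η) (G : H →L[ℝ] H) {e : H} (he : G e = l • e)
    (he1 : ‖e‖ = 1) (ρ : H) :
    |⟪regEstimator g x y n - ρ, empCov x n e⟫ - ⟪empNoise ρ x y n, e⟫|
      ≤ ‖ρ‖ * (η * ‖empCov x n‖ + c * (‖(G - empCov x n) e‖ / (l - c)))
        + ‖empNoise ρ x y n‖ * (η + ‖(G - empCov x n) e‖ / (l - c)) := by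
  obtain ⟨s, hres, hs, hF⟩ :=
    exists_isSpectralResolution (isCompactOperator_empCov x n) (isSymmetric_empCov x n)
  rw [regEstimator, empCrossCov_eq ρ]
  refine hres.abs_inner_sub_le (fun μ hμ => ?_) hc hcl hη g hg0 hg _ (hF g) G he he1 ρ _
  by_cases h0 : μ = 0
  · exact h0.ge
  · obtain ⟨v, hv0, hv⟩ := hs μ hμ h0
    have h1 := inner_empCov_self_nonneg x n v
    rw [hv, real_inner_smul_left] at h1
    exact nonneg_of_mul_nonneg_left h1 (real_inner_self_pos.2 hv0)

end EmpiricalCovariance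

/-! ### Second moments of Hilbert-valued averages, and Markov's inequality. -/

section SecondMoments

variable {Ω H : Type*} [MeasurableSpace Ω] [NormedAddCommGroup H] [InnerProductSpace ℝ H]
  {P : Measure Ω}

theorem MeasureTheory.MemLp.integrable_inner {u v : Ω → H} (hu : MemLp u 2 P) (hv : MemLp v 2 P) :
    Integrable (fun ω => ⟪u ω, v ω⟫) P := by
  refine ((hu.norm.integrable_mul hv.norm).mono' (hu.1.inner hv.1) (ae_of_all _ fun ω => ?_))
  exact abs_real_inner_le_norm _ _

/-- Independence and centering kill the cross terms, so the variances add. -/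
theorem integral_norm_sum_sq [CompleteSpace H] [MeasurableSpace H] [BorelSpace H]
    [IsFiniteMeasure P] {ξ : ℕ → Ω → H}
    (hindep : Pairwise fun i j => IndepFun (ξ i) (ξ j) P) (hL : ∀ i, MemLp (ξ i) 2 P)
    (h0 : ∀ i, ∫ ω, ξ i ω ∂P = 0) (n : ℕ) :
    ∫ ω, ‖∑ i ∈ Finset.range n, ξ i ω‖ ^ 2 ∂P = ∑ i ∈ Finset.range n, ∫ ω, ‖ξ i ω‖ ^ 2 ∂P := by
  induction n with
  | zero => simp
  | succ n ih =>
    have hS : MemLp (fun ω => ∑ i ∈ Finset.range n, ξ i ω) 2 P :=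
      memLp_finsetSum _ fun i _ => hL i
    have hcross : ∫ ω, ⟪∑ i ∈ Finset.range n, ξ i ω, ξ n ω⟫ ∂P = 0 := by
      simp_rw [sum_inner]
      rw [integral_finsetSum _ fun i _ => (hL i).integrable_inner (hL n)]
      refine Finset.sum_eq_zero fun i hi => ?_
      have := (hindep (Finset.mem_range.1 hi).ne).integral_bilin
        ((hL i).integrable (by norm_num)) ((hL n).integrable (by norm_num)) (innerSL ℝ)
      exact this.trans (by rw [h0, h0]; exact inner_zero_left _)
    simp_rw [Finset.sum_range_succ, norm_add_sq_real]
    have hS2 : Integrable (fun ω => ‖∑ i ∈ Finset.range n, ξ i ω‖ ^ 2) P :=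
      hS.integrable_norm_pow (by norm_num)
    have hn2 : Integrable (fun ω => ‖ξ n ω‖ ^ 2) P := (hL n).integrable_norm_pow (by norm_num)
    have hc2 : Integrable (fun ω => 2 * ⟪∑ i ∈ Finset.range n, ξ i ω, ξ n ω⟫) P :=
      (hS.integrable_inner (hL n)).const_mul 2
    rw [integral_add (by exact hS2.add hc2) hn2, integral_add hS2 hc2, integral_const_mul, hcross, ih]
    simp

/-- Equality holds for `n > 0`; the inequality also covers `n = 0`, where the average is `0`. -/
theorem integral_norm_sqrt_smul_average_sq_le [CompleteSpace H] [MeasurableSpace H] [BorelSpace H]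
    [IsFiniteMeasure P] {ξ : ℕ → Ω → H} {ζ : Ω → H} (hindep : iIndepFun ξ P)
    (hid : ∀ i, IdentDistrib (ξ i) ζ P P) (hL : MemLp ζ 2 P) (h0 : ∫ ω, ζ ω ∂P = 0) (n : ℕ) :
    Integrable (fun ω => ‖√(n : ℝ) • (n : ℝ)⁻¹ • ∑ i ∈ Finset.range n, ξ i ω‖ ^ 2) P ∧
      ∫ ω, ‖√(n : ℝ) • (n : ℝ)⁻¹ • ∑ i ∈ Finset.range n, ξ i ω‖ ^ 2 ∂P ≤ ∫ ω, ‖ζ ω‖ ^ 2 ∂P := by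
  have hLi : ∀ i, MemLp (ξ i) 2 P := fun i => (hid i).memLp_iff.2 hL
  have hS : MemLp (fun ω => ∑ i ∈ Finset.range n, ξ i ω) 2 P := memLp_finsetSum _ fun i _ => hLi i
  refine ⟨((hS.const_smul _).const_smul _).integrable_norm_pow (by norm_num), ?_⟩
  have h1 : ∀ ω, ‖√(n : ℝ) • (n : ℝ)⁻¹ • ∑ i ∈ Finset.range n, ξ i ω‖ ^ 2
      = (n : ℝ)⁻¹ * ‖∑ i ∈ Finset.range n, ξ i ω‖ ^ 2 := fun ω => by
    rcases Nat.eq_zero_or_pos n with rfl | hn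
    · simp
    · rw [norm_smul, norm_smul, mul_pow, mul_pow, Real.norm_of_nonneg (Real.sqrt_nonneg _),
        Real.sq_sqrt n.cast_nonneg, norm_inv, RCLike.norm_natCast]
      field_simp
  simp_rw [h1]
  rw [integral_const_mul, integral_norm_sum_sq (fun i j hij => hindep.indepFun hij) hLi
    (fun i => by rw [(hid i).integral_eq, h0])]
  have h2 : ∀ i, ∫ ω, ‖ξ i ω‖ ^ 2 ∂P = ∫ ω, ‖ζ ω‖ ^ 2 ∂P := fun i =>
    ((hid i).comp (u := fun x : H => ‖x‖ ^ 2) (by fun_prop)).integral_eq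
  simp_rw [h2, Finset.sum_const, Finset.card_range, nsmul_eq_mul, ← mul_assoc]
  have h3 : (n : ℝ)⁻¹ * n ≤ 1 := inv_mul_le_one
  have h4 : 0 ≤ ∫ ω, ‖ζ ω‖ ^ 2 ∂P := integral_nonneg fun _ => by positivity
  nlinarith

/-- Markov: a sequence dominated by integrable variables with vanishing mean tends to zero in
measure. -/
theorem tendstoInMeasure_zero_of_norm_le {E : Type*} [SeminormedAddCommGroup E] [IsFiniteMeasure P]
    {r : ℕ → Ω → E} {b : ℕ → Ω → ℝ} (hrb : ∀ᶠ n in atTop, ∀ ω, ‖r n ω‖ ≤ b n ω)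
    (hb : ∀ n, Integrable (b n) P) (hlim : Tendsto (fun n => ∫ ω, b n ω ∂P) atTop (𝓝 0)) :
    TendstoInMeasure P r atTop 0 := by
  rw [tendstoInMeasure_iff_measureReal_norm]
  intro δ hδ
  refine tendsto_of_tendsto_of_tendsto_of_le_of_le' (g := fun _ => 0)
    (h := fun n => (∫ ω, b n ω ∂P) / δ) tendsto_const_nhds (by simpa using hlim.div_const δ)
    (Eventually.of_forall fun _ => measureReal_nonneg) ?_
  filter_upwards [hrb] with n hn
  have hle : P.real {ω | δ ≤ ‖r n ω - (0 : Ω → E) ω‖} ≤ P.real {ω | δ ≤ b n ω} := by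
    refine measureReal_mono fun ω hω => ?_
    simp only [Set.mem_ofPred_eq, Pi.zero_apply, sub_zero] at hω ⊢
    exact hω.trans (hn ω)
  refine hle.trans ?_
  rw [le_div_iff₀' hδ]
  exact mul_meas_ge_le_integral_of_nonneg
    (ae_of_all _ fun ω => (norm_nonneg _).trans (hn ω)) (hb n) δ

end SecondMoments

/-! ### Moments of `ε X` under the conditional hypotheses on the error. -/

namespace IsFunctionalLinearModel

variable {Ω H : Type*} [MeasurableSpace Ω] [NormedAddCommGroup H] [InnerProductSpace ℝ H]
  [CompleteSpace H] [MeasurableSpace H] [BorelSpace H] {P : Measure Ω} [IsProbabilityMeasure P]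
  {X : Ω → H} {Y : Ω → ℝ} {ρ : H} {σ : ℝ}

theorem memLp_two_X (h : IsFunctionalLinearModel P X Y ρ σ) : MemLp X 2 P :=
  h.memLp_X.mono_exponent (by norm_num)

theorem memLp_id_map (h : IsFunctionalLinearModel P X Y ρ σ)
    [SecondCountableTopology H] : MemLp id 2 (P.map X) :=
  (memLp_map_measure_iff aestronglyMeasurable_id h.measurable_X.aemeasurable).2 h.memLp_two_X

theorem memLp_error (h : IsFunctionalLinearModel P X Y ρ σ) :
    MemLp (fun ω => Y ω - ⟪ρ, X ω⟫) 2 P :=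
  h.memLp_Y.sub (h.memLp_two_X.const_inner ρ)

/-- Constant conditional variance says that weighting `P` by `ε²` multiplies the law of `X` by `σ²`.
Working with `∫⁻` requires no integrability, so that of `‖ε X‖²` can be deduced from it. -/
theorem lintegral_error_sq_mul [SecondCountableTopology H]
    (h : IsFunctionalLinearModel P X Y ρ σ) {g : H → ℝ≥0∞} (hg : Measurable g) :
    ∫⁻ ω, ENNReal.ofReal ((Y ω - ⟪ρ, X ω⟫) ^ 2) * g (X ω) ∂P
      = ENNReal.ofReal (σ ^ 2) * ∫⁻ ω, g (X ω) ∂P := by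
  have hX := h.measurable_X
  have hY := h.measurable_Y
  have hd : Measurable fun ω => ENNReal.ofReal ((Y ω - ⟪ρ, X ω⟫) ^ 2) := by fun_prop
  have hint : Integrable (fun ω => (Y ω - ⟪ρ, X ω⟫) ^ 2) P := h.memLp_error.integrable_sq
  have hmap : (P.withDensity fun ω => ENNReal.ofReal ((Y ω - ⟪ρ, X ω⟫) ^ 2)).map X
      = ENNReal.ofReal (σ ^ 2) • P.map X := by
    ext B hB
    have hXB := hX hB
    rw [Measure.map_apply hX hB, withDensity_apply _ hXB, Measure.smul_apply,
      Measure.map_apply hX hB, ← ofReal_integral_eq_lintegral_ofReal hint.integrableOn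
        (ae_of_all _ fun _ => sq_nonneg _),
      ← setIntegral_condExp hX.comap_le hint ⟨B, hB, rfl⟩,
      setIntegral_congr_ae hXB (h.condExp_error_sq.mono fun ω hω _ => hω)]
    simp only [setIntegral_const, smul_eq_mul]
    rw [ENNReal.ofReal_mul measureReal_nonneg, measureReal_def,
      ENNReal.ofReal_toReal (measure_ne_top _ _), mul_comm]
  calc _ = ∫⁻ ω, g (X ω) ∂(P.withDensity fun ω => ENNReal.ofReal ((Y ω - ⟪ρ, X ω⟫) ^ 2)) := by
        exact (lintegral_withDensity_eq_lintegral_mul P hd (hg.comp hX)).symm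
    _ = _ := by
        rw [← lintegral_map hg hX, hmap, lintegral_smul_measure, lintegral_map hg hX, smul_eq_mul]

/-- Here `𝔼 ε² ‖X‖² = σ² 𝔼 ‖X‖²`; Hölder would not suffice, as `ε` is only known to be square
integrable. -/
theorem memLp_error_smul [SecondCountableTopology H] (h : IsFunctionalLinearModel P X Y ρ σ) :
    MemLp (fun ω => (Y ω - ⟪ρ, X ω⟫) • X ω) 2 P := by
  have hX := h.measurable_X
  have hY := h.measurable_Y
  have hm : AEStronglyMeasurable (fun ω => (Y ω - ⟪ρ, X ω⟫) • X ω) P :=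
    Measurable.aestronglyMeasurable (by fun_prop)
  refine (memLp_two_iff_integrable_sq_norm hm).2 ⟨by fun_prop, ?_⟩
  have h1 := h.lintegral_error_sq_mul (g := fun x => ENNReal.ofReal (‖x‖ ^ 2)) (by fun_prop)
  have h2 : ∫⁻ ω, ENNReal.ofReal (‖X ω‖ ^ 2) ∂P ≠ ⊤ :=
    ((hasFiniteIntegral_iff_ofReal (ae_of_all _ fun _ => by positivity)).1
      (h.memLp_two_X.integrable_norm_pow (by norm_num)).2).ne
  rw [hasFiniteIntegral_iff_ofReal (ae_of_all _ fun _ => by positivity)]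
  simp_rw [← ENNReal.ofReal_mul (sq_nonneg _)] at h1
  simp_rw [norm_smul, mul_pow, Real.norm_eq_abs, sq_abs]
  rw [h1]
  exact ENNReal.mul_lt_top ENNReal.ofReal_lt_top h2.lt_top

theorem integral_error_mul_inner_sq [SecondCountableTopology H]
    (h : IsFunctionalLinearModel P X Y ρ σ) (v : H) :
    ∫ ω, (⟪(Y ω - ⟪ρ, X ω⟫) • X ω, v⟫) ^ 2 ∂P
      = σ ^ 2 * ⟪covarianceOperator (P.map X) v, v⟫ := by
  have hX := h.measurable_X
  have hY := h.measurable_Y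
  have h1 := h.lintegral_error_sq_mul (g := fun x => ENNReal.ofReal (⟪v, x⟫ ^ 2)) (by fun_prop)
  simp_rw [← ENNReal.ofReal_mul (sq_nonneg _)] at h1
  rw [covarianceOperator_inner h.memLp_id_map, integral_map hX.aemeasurable
      (Measurable.aestronglyMeasurable (by fun_prop)),
    integral_eq_lintegral_of_nonneg_ae (ae_of_all _ fun _ => sq_nonneg _)
      (Measurable.aestronglyMeasurable (by fun_prop)),
    integral_eq_lintegral_of_nonneg_ae (ae_of_all _ fun _ => mul_self_nonneg _)
      (Measurable.aestronglyMeasurable (by fun_prop))]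
  simp_rw [real_inner_smul_left, mul_pow, real_inner_comm v, ← sq]
  rw [h1, ENNReal.toReal_mul, ENNReal.toReal_ofReal (sq_nonneg _)]

theorem integral_error_smul [SecondCountableTopology H] (h : IsFunctionalLinearModel P X Y ρ σ) :
    ∫ ω, (Y ω - ⟪ρ, X ω⟫) • X ω ∂P = 0 := by
  have hX := h.measurable_X
  refine ext_inner_left ℝ fun v => ?_
  rw [← integral_inner (h.memLp_error_smul.integrable (by norm_num)), inner_zero_right]
  have hsm : StronglyMeasurable[MeasurableSpace.comap X inferInstance] fun ω => ⟪v, X ω⟫ :=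
    (((measurable_const.inner measurable_id).comp
      (comap_measurable X)) : Measurable[MeasurableSpace.comap X inferInstance]
        fun ω => ⟪v, X ω⟫).stronglyMeasurable
  have hint : Integrable (fun ω => ⟪v, X ω⟫ * (Y ω - ⟪ρ, X ω⟫)) P :=
    (h.memLp_two_X.const_inner v).integrable_mul h.memLp_error
  have h1 := condExp_mul_of_stronglyMeasurable_left hsm hint (h.memLp_error.integrable (by norm_num))
  simp_rw [real_inner_smul_right, mul_comm (Y _ - _)]
  rw [← integral_condExp hX.comap_le]
  refine (integral_congr_ae (h1.trans ?_)).trans (integral_zero Ω ℝ)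
  filter_upwards [h.condExp_error] with ω hω
  rw [Pi.mul_apply, hω, mul_zero]

end IsFunctionalLinearModel

/-! ### Compactness of the covariance operator and totality of its eigenvectors. -/

section CovarianceOperator

variable {H : Type*} [NormedAddCommGroup H] [InnerProductSpace ℝ H] [CompleteSpace H]
  [MeasurableSpace H] [BorelSpace H]

/-- The covariance operator is a Bochner mean of rank-one operators, and compact operators form a
closed convex set. -/
theorem isCompactOperator_covarianceOperator [SecondCountableTopology H] {μ : Measure H}
    [IsProbabilityMeasure μ] (hμ : MemLp id 2 μ) :
    IsCompactOperator (covarianceOperator μ) := by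
  have hcont : Continuous fun x : H => InnerProductSpace.rankOne ℝ x x :=
    (InnerProductSpace.rankOne ℝ (E := H) (F := H)).continuous.clm_apply continuous_id
  have hint : Integrable (fun x : H => InnerProductSpace.rankOne ℝ x x) μ := by
    refine (hμ.integrable_norm_pow (by norm_num)).mono' hcont.aestronglyMeasurable
      (ae_of_all _ fun x => ?_)
    rw [InnerProductSpace.norm_rankOne, ← sq, id]
  have heq : covarianceOperator μ = ∫ x, InnerProductSpace.rankOne ℝ x x ∂μ := by
    ext v
    rw [covarianceOperator_apply hμ, ContinuousLinearMap.integral_apply hint]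
    simp_rw [InnerProductSpace.rankOne_apply, real_inner_comm]
  have hcomp : ∀ x : H, IsCompactOperator (InnerProductSpace.rankOne ℝ x x) := fun x =>
    IsCompactOperator.clm_comp (f := innerSL ℝ x)
      (isCompactOperator_of_locallyCompactSpace_dom _)
      (ContinuousLinearMap.toSpanSingleton ℝ x)
  rw [heq]
  exact (compactOperator (RingHom.id ℝ) H H).convex.integral_mem
    isClosed_setOfPred_isCompactOperator (ae_of_all _ hcomp) hint

end CovarianceOperator

/-- With trivial kernel, every eigenvector is a multiple of some `e j`, so `z` is orthogonal to all
eigenspaces, and these are total. -/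
theorem IsSimpleSpectrum.eq_zero_of_forall_inner_eq_zero {H : Type*} [NormedAddCommGroup H]
    [InnerProductSpace ℝ H] [CompleteSpace H] {T : H →L[ℝ] H} {lam : ℕ → ℝ} {e : ℕ → H}
    (h : IsSimpleSpectrum T lam e) (hT : IsCompactOperator T)
    (hsymm : (T : H →ₗ[ℝ] H).IsSymmetric) (hker : ∀ v, T v = 0 → v = 0) {z : H}
    (hz : ∀ j, ⟪e j, z⟫ = 0) : z = 0 := by
  have hperp : z ∈ (⨆ μ, Module.End.eigenspace (T : Module.End ℝ H) μ)ᗮ := by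
    rw [← Submodule.iInf_orthogonal, Submodule.mem_iInf]
    intro μ
    rw [Submodule.mem_orthogonal]
    intro v hv
    have hTv : T v = μ • v := Module.End.mem_eigenspace_iff.1 hv
    by_cases hv0 : v = 0
    · rw [hv0, inner_zero_left]
    by_cases hμ : μ = 0
    · exact absurd (hker v (by rw [hTv, hμ, zero_smul])) hv0
    obtain ⟨j, -, hj⟩ := h.exhaust μ v hμ hv0 hTv
    obtain ⟨a, rfl⟩ := Submodule.mem_span_singleton.1 hj
    rw [real_inner_smul_left, hz, mul_zero]
  rwa [ContinuousLinearMap.orthogonalComplement_iSup_eigenspaces_eq_bot hT hsymm,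
    Submodule.mem_bot] at hperp

/-- Extracts one null sequence of bounds from a uniform limit, namely the suprema. The bound holds
only eventually because `sSup` of an unbounded set is `0`. -/
theorem exists_tendsto_zero_bound {S : ℕ → Set ℝ} {φ : ℕ → ℝ → ℝ} (h0 : ∀ n x, 0 ≤ φ n x)
    (h : ∀ δ > 0, ∀ᶠ n in atTop, ∀ x ∈ S n, φ n x ≤ δ) :
    ∃ t : ℕ → ℝ, (∀ n, 0 ≤ t n) ∧ Tendsto t atTop (𝓝 0) ∧
      ∀ᶠ n in atTop, ∀ x ∈ S n, φ n x ≤ t n := by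
  have hnn : ∀ n, 0 ≤ sSup (φ n '' S n) := fun n =>
    Real.sSup_nonneg (by rintro _ ⟨x, -, rfl⟩; exact h0 n x)
  refine ⟨fun n => sSup (φ n '' S n), hnn, ?_, ?_⟩
  · rw [Metric.tendsto_atTop']
    intro δ hδ
    obtain ⟨N, hN⟩ := eventually_atTop.1 (h (δ / 2) (half_pos hδ))
    refine ⟨N, fun n hn => ?_⟩
    rw [Real.dist_eq, sub_zero, abs_of_nonneg (hnn n)]
    refine lt_of_le_of_lt (Real.sSup_le ?_ (half_pos hδ).le) (half_lt_self hδ)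
    rintro _ ⟨x, hx, rfl⟩
    exact hN n hn.le x hx
  · filter_upwards [h 1 one_pos] with n hn x hx
    exact le_csSup ⟨1, by rintro _ ⟨y, hy, rfl⟩; exact hn y hy⟩ ⟨x, hx, rfl⟩

theorem measurable_empCov_apply {Ω H : Type*} [MeasurableSpace Ω] [NormedAddCommGroup H]
    [InnerProductSpace ℝ H] [MeasurableSpace H] [BorelSpace H] [SecondCountableTopology H]
    {P : Measure Ω} {X : Ω → H} {Y : Ω → ℝ} {Xs : ℕ → Ω → H} {Ys : ℕ → Ω → ℝ}
    (hs : IsIIDSample P X Y Xs Ys) (v : H) (n : ℕ) :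
    Measurable fun ω => empCov (fun i => Xs i ω) n v := by
  have := hs.measurable_X
  simp_rw [empCov_apply]
  fun_prop

/-! ### Root-`n` moment bounds and the scalar central limit theorem. -/

section Sample

variable {Ω H : Type*} [MeasurableSpace Ω] [NormedAddCommGroup H] [InnerProductSpace ℝ H]
  [CompleteSpace H] [MeasurableSpace H] [BorelSpace H]
  {P : Measure Ω} [IsProbabilityMeasure P]
  {X : Ω → H} {Y : Ω → ℝ} {ρ : H} {σ : ℝ} {Xs : ℕ → Ω → H} {Ys : ℕ → Ω → ℝ}

theorem average_norm_sq_moment (hm : IsFunctionalLinearModel P X Y ρ σ)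
    (hs : IsIIDSample P X Y Xs Ys) :
    ∃ C : ℝ, ∀ n : ℕ,
      Integrable (fun ω => (n : ℝ)⁻¹ * ∑ i ∈ Finset.range n, ‖Xs i ω‖ ^ 2) P ∧
      ∫ ω, (n : ℝ)⁻¹ * ∑ i ∈ Finset.range n, ‖Xs i ω‖ ^ 2 ∂P ≤ C := by
  have hφ : Measurable fun p : H × ℝ => ‖p.1‖ ^ 2 := by fun_prop
  have hid := fun i => (hs.identDistrib i).comp hφ
  have hint : Integrable (fun ω => ‖X ω‖ ^ 2) P :=
    hm.memLp_two_X.integrable_norm_pow (by norm_num)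
  have hinti : ∀ i, Integrable (fun ω => ‖Xs i ω‖ ^ 2) P := fun i => (hid i).integrable_iff.2 hint
  have hEi : ∀ i, ∫ ω, ‖Xs i ω‖ ^ 2 ∂P = ∫ ω, ‖X ω‖ ^ 2 ∂P := fun i => (hid i).integral_eq
  refine ⟨∫ ω, ‖X ω‖ ^ 2 ∂P, fun n => ⟨(integrable_finsetSum _ fun i _ => hinti i).const_mul _, ?_⟩⟩
  rw [integral_const_mul, integral_finsetSum _ fun i _ => hinti i]
  simp_rw [hEi, Finset.sum_const, Finset.card_range, nsmul_eq_mul, ← mul_assoc]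
  exact mul_le_of_le_one_left (integral_nonneg fun _ => by positivity) inv_mul_le_one

variable [SecondCountableTopology H]

theorem sqrt_smul_empNoise_moment (hm : IsFunctionalLinearModel P X Y ρ σ)
    (hs : IsIIDSample P X Y Xs Ys) :
    ∃ C : ℝ, ∀ n : ℕ,
      Integrable (fun ω => ‖√(n : ℝ) • empNoise ρ (fun i => Xs i ω) (fun i => Ys i ω) n‖ ^ 2) P ∧
      ∫ ω, ‖√(n : ℝ) • empNoise ρ (fun i => Xs i ω) (fun i => Ys i ω) n‖ ^ 2 ∂P ≤ C := by
  have hφ : Measurable fun p : H × ℝ => (p.2 - ⟪ρ, p.1⟫) • p.1 := by fun_prop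
  exact ⟨_, integral_norm_sqrt_smul_average_sq_le (hs.indep.comp _ fun _ => hφ)
    (fun i => (hs.identDistrib i).comp hφ) hm.memLp_error_smul hm.integral_error_smul⟩

theorem sqrt_smul_covarianceOperator_sub_empCov_moment (hm : IsFunctionalLinearModel P X Y ρ σ)
    (hs : IsIIDSample P X Y Xs Ys) (v : H) :
    ∃ C : ℝ, ∀ n : ℕ,
      Integrable (fun ω => ‖√(n : ℝ) •
        (covarianceOperator (P.map X) - empCov (fun i => Xs i ω) n) v‖ ^ 2) P ∧
      ∫ ω, ‖√(n : ℝ) •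
        (covarianceOperator (P.map X) - empCov (fun i => Xs i ω) n) v‖ ^ 2 ∂P ≤ C := by
  set w := covarianceOperator (P.map X) v with hw
  have hX := hm.measurable_X
  have hφ : Measurable fun p : H × ℝ => w - ⟪p.1, v⟫ • p.1 := by fun_prop
  -- This is where the fourth moment of `X` enters.
  have hXX : MemLp (fun ω => ⟪X ω, v⟫ • X ω) 2 P := by
    have hmeas : AEStronglyMeasurable (fun ω => ⟪X ω, v⟫ • X ω) P :=
      Measurable.aestronglyMeasurable (by fun_prop)
    rw [memLp_two_iff_integrable_sq_norm hmeas]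
    have h4 : Integrable (fun ω => ‖X ω‖ ^ 4) P := hm.memLp_X.integrable_norm_pow (by norm_num)
    refine (h4.const_mul (‖v‖ ^ 2)).mono' (hmeas.norm.pow 2) (ae_of_all _ fun ω => ?_)
    rw [Real.norm_of_nonneg (by positivity), norm_smul]
    calc (‖⟪X ω, v⟫‖ * ‖X ω‖) ^ 2 ≤ (‖X ω‖ * ‖v‖ * ‖X ω‖) ^ 2 := by
          gcongr; exact norm_inner_le_norm _ _
      _ = _ := by ring
  have hmean : ∫ ω, (w - ⟪X ω, v⟫ • X ω) ∂P = 0 := by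
    rw [integral_sub (integrable_const _) (hXX.integrable (by norm_num)), hw,
      covarianceOperator_apply hm.memLp_id_map, integral_map hX.aemeasurable
        (Measurable.aestronglyMeasurable (by fun_prop))]
    simp_rw [real_inner_comm v]
    simp
  have key := fun n => integral_norm_sqrt_smul_average_sq_le (hs.indep.comp _ fun _ => hφ)
    (fun i => (hs.identDistrib i).comp hφ) ((memLp_const w).sub hXX) hmean n
  have heq : ∀ (n : ℕ) ω, √(n : ℝ) • (covarianceOperator (P.map X) - empCov (fun i => Xs i ω) n) v
      = √(n : ℝ) • (n : ℝ)⁻¹ • ∑ i ∈ Finset.range n, (w - ⟪Xs i ω, v⟫ • Xs i ω) := fun n ω => by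
    rcases Nat.eq_zero_or_pos n with rfl | hn
    · simp
    · rw [sub_apply, empCov_apply, Finset.sum_sub_distrib, smul_sub (n : ℝ)⁻¹, Finset.sum_const,
        Finset.card_range, ← Nat.cast_smul_eq_nsmul ℝ, inv_smul_smul₀ (by positivity)]
  simp_rw [heq]
  exact ⟨_, key⟩

/-- The real central limit theorem for the i.i.d. centered variables `⟪ε_i X_i, v⟫`, whose variance
is `σ² ⟪Γ v, v⟫`. -/
theorem tendstoInDistribution_sqrt_mul_inner_empNoise (hm : IsFunctionalLinearModel P X Y ρ σ)
    (hs : IsIIDSample P X Y Xs Ys) (v : H) :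
    TendstoInDistribution
      (fun (n : ℕ) ω => √(n : ℝ) * ⟪empNoise ρ (fun i => Xs i ω) (fun i => Ys i ω) n, v⟫) atTop id
      (fun _ => P) (gaussianReal 0 (σ ^ 2 * ⟪covarianceOperator (P.map X) v, v⟫).toNNReal) := by
  have hφ : Measurable fun p : H × ℝ => ⟪(p.2 - ⟪ρ, p.1⟫) • p.1, v⟫ := by fun_prop
  have hX := hm.measurable_X
  have hY := hm.measurable_Y
  have hid := fun i => (hs.identDistrib i).comp hφ
  set ξ : ℕ → Ω → ℝ := fun i ω => ⟪(Ys i ω - ⟪ρ, Xs i ω⟫) • Xs i ω, v⟫ with hξ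
  have hL : MemLp (fun ω => ⟪(Y ω - ⟪ρ, X ω⟫) • X ω, v⟫) 2 P := hm.memLp_error_smul.inner_const v
  have hmean : ∫ ω, ⟪(Y ω - ⟪ρ, X ω⟫) • X ω, v⟫ ∂P = 0 := by
    simp_rw [real_inner_comm v]
    rw [integral_inner (hm.memLp_error_smul.integrable (by norm_num)), hm.integral_error_smul,
      inner_zero_right]
  have hmean0 : ∫ ω, ξ 0 ω ∂P = 0 := (hid 0).integral_eq.trans hmean
  have hvar : Var[ξ 0; P] = σ ^ 2 * ⟪covarianceOperator (P.map X) v, v⟫ := by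
    have h1 : Var[ξ 0; P] = Var[fun ω => ⟪(Y ω - ⟪ρ, X ω⟫) • X ω, v⟫; P] := (hid 0).variance_eq
    rw [h1, variance_of_integral_eq_zero hL.1.aemeasurable hmean]
    exact hm.integral_error_mul_inner_sq v
  have hclt := tendstoInDistribution_inv_sqrt_mul_sum_sub (P := P) (X := ξ) (Y := id)
    (P' := gaussianReal 0 Var[ξ 0; P].toNNReal) ⟨aemeasurable_id, Measure.map_id⟩
    ((hid 0).memLp_iff.2 hL) (hs.indep.comp _ fun _ => hφ) (fun i => (hid i).trans (hid 0).symm)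
  rw [hvar, hmean0] at hclt
  convert hclt using 3 with n ω
  simp only [empNoise, hξ, real_inner_smul_left, sum_inner, mul_zero, sub_zero]
  rw [← mul_assoc, ← div_eq_mul_inv, Real.sqrt_div_self', one_div]

end Sample

theorem tendsto_inv_sqrt_natCast_atTop : Tendsto (fun n : ℕ => (√(n : ℝ))⁻¹) atTop (𝓝 0) :=
  tendsto_inv_atTop_zero.comp (Real.tendsto_sqrt_atTop.comp tendsto_natCast_atTop_atTop)

/-! ### Consistency of `Γ_n v` and negligibility of the remainder. -/

section Remainder

variable {Ω H : Type*} [MeasurableSpace Ω] [NormedAddCommGroup H] [InnerProductSpace ℝ H]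
  [CompleteSpace H] [MeasurableSpace H] [BorelSpace H] [SecondCountableTopology H]
  {P : Measure Ω} [IsProbabilityMeasure P]
  {X : Ω → H} {Y : Ω → ℝ} {ρ : H} {σ : ℝ} {Xs : ℕ → Ω → H} {Ys : ℕ → Ω → ℝ}

theorem tendstoInMeasure_empCov_apply (hm : IsFunctionalLinearModel P X Y ρ σ)
    (hs : IsIIDSample P X Y Xs Ys) (v : H) :
    TendstoInMeasure P (fun n ω => empCov (fun i => Xs i ω) n v) atTop
      fun _ => covarianceOperator (P.map X) v := by
  obtain ⟨C, hC⟩ := sqrt_smul_covarianceOperator_sub_empCov_moment hm hs v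
  set G := covarianceOperator (P.map X)
  set d : ℕ → Ω → H := fun n ω => √(n : ℝ) • (G - empCov (fun i => Xs i ω) n) v with hd
  have h0 : TendstoInMeasure P (fun n ω => empCov (fun i => Xs i ω) n v - G v) atTop 0 := by
    -- The inequality `x ≤ 1 + x²` lets second moments alone control the first power of `‖d n ω‖`.
    refine tendstoInMeasure_zero_of_norm_le
      (b := fun n ω => (√(n : ℝ))⁻¹ * (1 + ‖d n ω‖ ^ 2)) ?_
      (fun n => ((integrable_const 1).add (hC n).1).const_mul _) ?_
    · filter_upwards [eventually_gt_atTop 0] with n hn ω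
      have hsq : 0 < √(n : ℝ) := by positivity
      have h1 : ‖empCov (fun i => Xs i ω) n v - G v‖ = (√(n : ℝ))⁻¹ * ‖d n ω‖ := by
        rw [hd, norm_smul, Real.norm_of_nonneg hsq.le, inv_mul_cancel_left₀ hsq.ne', sub_apply,
          norm_sub_rev]
      rw [h1]
      gcongr
      nlinarith [sq_nonneg (‖d n ω‖ - 1)]
    · refine squeeze_zero (g := fun n : ℕ => (√(n : ℝ))⁻¹ * (1 + C))
        (fun n => integral_nonneg fun ω => by positivity) (fun n => ?_)
        (by simpa using tendsto_inv_sqrt_natCast_atTop.mul_const (1 + C))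
      rw [integral_const_mul, integral_add (integrable_const 1) (hC n).1]
      gcongr
      · simp
      · exact (hC n).2
  rw [tendstoInMeasure_iff_norm] at h0 ⊢
  simpa using h0

/-- Tested against `Γ_n e`, with `e` an eigenvector of the covariance operator, the error of the
regularized estimator is asymptotically the linear statistic `⟪U_n, e⟫`. -/
theorem tendstoInMeasure_sqrt_mul_inner_regEstimator_sub (hm : IsFunctionalLinearModel P X Y ρ σ)
    (hs : IsIIDSample P X Y Xs Ys) {l : ℝ} {e : H} (hl : 0 < l)
    (he : covarianceOperator (P.map X) e = l • e) (he1 : ‖e‖ = 1)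
    {lam1 lam2 : ℝ} {c : ℕ → ℝ} {f : ℕ → ℝ → ℝ} (hreg : IsRegularization lam1 lam2 c f) :
    TendstoInMeasure P (fun (n : ℕ) ω => √(n : ℝ) *
      (⟪regEstimator (f n) (fun i => Xs i ω) (fun i => Ys i ω) n - ρ,
          empCov (fun i => Xs i ω) n e⟫
        - ⟪empNoise ρ (fun i => Xs i ω) (fun i => Ys i ω) n, e⟫)) atTop 0 := by
  obtain ⟨Cd, hd⟩ := sqrt_smul_covarianceOperator_sub_empCov_moment hm hs e
  obtain ⟨Cu, hu⟩ := sqrt_smul_empNoise_moment hm hs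
  obtain ⟨Cg, hg⟩ := average_norm_sq_moment hm hs
  obtain ⟨t, ht0, ht, htf⟩ := exists_tendsto_zero_bound (S := fun n => Set.Ici (c n))
    (φ := fun n x => √(n : ℝ) * |x * f n x - 1|) (fun n x => by positivity) hreg.approx_rate
  set G := covarianceOperator (P.map X)
  set d : ℕ → Ω → H := fun n ω => √(n : ℝ) • (G - empCov (fun i => Xs i ω) n) e with hd_def
  set u : ℕ → Ω → H := fun n ω =>
    √(n : ℝ) • empNoise ρ (fun i => Xs i ω) (fun i => Ys i ω) n with hu_def
  set g : ℕ → Ω → ℝ := fun n ω => (n : ℝ)⁻¹ * ∑ i ∈ Finset.range n, ‖Xs i ω‖ ^ 2 with hg_def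
  have hint1 : ∀ n, Integrable (fun ω => ‖ρ‖ * t n * g n ω) P := fun n => (hg n).1.const_mul _
  have hint2 : ∀ n, Integrable (fun ω => ‖ρ‖ * c n * (2 / l) * (1 + ‖d n ω‖ ^ 2)) P := fun n =>
    ((integrable_const 1).add (hd n).1).const_mul _
  have hint3 : ∀ n, Integrable (fun ω => t n * (1 + ‖u n ω‖ ^ 2)) P := fun n =>
    ((integrable_const 1).add (hu n).1).const_mul _
  have hint4 : ∀ n : ℕ,
      Integrable (fun ω => 2 / l * (√(n : ℝ))⁻¹ * (‖u n ω‖ ^ 2 + ‖d n ω‖ ^ 2)) P := fun n =>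
    ((hu n).1.add (hd n).1).const_mul _
  have hint12 : ∀ n, Integrable (fun ω => ‖ρ‖ * t n * g n ω
      + ‖ρ‖ * c n * (2 / l) * (1 + ‖d n ω‖ ^ 2)) P := fun n => (hint1 n).add (hint2 n)
  have hint34 : ∀ n : ℕ, Integrable (fun ω => t n * (1 + ‖u n ω‖ ^ 2)
      + 2 / l * (√(n : ℝ))⁻¹ * (‖u n ω‖ ^ 2 + ‖d n ω‖ ^ 2)) P := fun n => (hint3 n).add (hint4 n)
  -- The summands bound, in order, the bias from `x f_n(x) ≠ 1` on the kept spectrum, the bias from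
  -- the discarded spectrum, and the noise paired with each of these two defects. The random factors
  -- are bounded in mean, and the prefactors `t n`, `c n`, `t n`, `n^{-1/2}` vanish.
  refine tendstoInMeasure_zero_of_norm_le (b := fun n ω =>
    (‖ρ‖ * t n * g n ω + ‖ρ‖ * c n * (2 / l) * (1 + ‖d n ω‖ ^ 2))
      + (t n * (1 + ‖u n ω‖ ^ 2) + 2 / l * (√(n : ℝ))⁻¹ * (‖u n ω‖ ^ 2 + ‖d n ω‖ ^ 2)))
    ?_ (fun n => (hint12 n).add (hint34 n)) ?_
  -- Keeping `c n` below `l / 2` bounds `1 / (l - c n)` by `2 / l`.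
  · have hcl : ∀ᶠ n in atTop, c n < l / 2 :=
      hreg.threshold_tendsto.eventually_lt_const (by positivity)
    filter_upwards [hcl, htf, eventually_gt_atTop 0] with n hcn htn hn ω
    have hc := hreg.threshold_pos n
    have hsq : 0 < √(n : ℝ) := by positivity
    have hsq1 : 1 ≤ √(n : ℝ) := Real.one_le_sqrt.2 (by exact_mod_cast hn)
    have hη : ∀ x, c n ≤ x → |x * f n x - 1| ≤ t n / √(n : ℝ) := fun x hx => by
      rw [le_div_iff₀' hsq]; exact htn x hx
    have key := abs_inner_regEstimator_sub_le (fun i => Xs i ω) (fun i => Ys i ω) n hc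
      (by linarith) (div_nonneg (ht0 n) hsq.le) (f n) (hreg.eq_zero n) hη G he he1 ρ
    set T := empCov (fun i => Xs i ω) n with hT
    set U := empNoise ρ (fun i => Xs i ω) (fun i => Ys i ω) n with hU
    have hdn : ‖d n ω‖ = √(n : ℝ) * ‖(G - T) e‖ := by
      rw [hd_def, norm_smul, Real.norm_of_nonneg hsq.le]
    have hun : ‖u n ω‖ = √(n : ℝ) * ‖U‖ := by
      rw [hu_def, norm_smul, Real.norm_of_nonneg hsq.le]
    have hTg : ‖T‖ ≤ g n ω := norm_empCov_le _ _
    have hdiv : ‖(G - T) e‖ / (l - c n) ≤ 2 / l * ‖(G - T) e‖ := by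
      rw [div_mul_eq_mul_div, div_le_div_iff₀ (by linarith) hl]
      nlinarith [norm_nonneg ((G - T) e)]
    rw [norm_mul, Real.norm_of_nonneg hsq.le, Real.norm_eq_abs]
    calc √(n : ℝ) * |⟪regEstimator (f n) (fun i => Xs i ω) (fun i => Ys i ω) n - ρ, T e⟫ - ⟪U, e⟫|
        ≤ √(n : ℝ) * (‖ρ‖ * (t n / √(n : ℝ) * g n ω + c n * (2 / l * ‖(G - T) e‖))
          + ‖U‖ * (t n / √(n : ℝ) + 2 / l * ‖(G - T) e‖)) := by
          refine mul_le_mul_of_nonneg_left (key.trans ?_) hsq.le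
          have := div_nonneg (ht0 n) hsq.le
          gcongr
      _ = ‖ρ‖ * t n * g n ω + ‖ρ‖ * c n * (2 / l) * ‖d n ω‖
          + ((√(n : ℝ))⁻¹ * t n * ‖u n ω‖ + 2 / l * (√(n : ℝ))⁻¹ * (‖u n ω‖ * ‖d n ω‖)) := by
          rw [hdn, hun]; field_simp
      _ ≤ _ := by
          have h1 : ‖d n ω‖ ≤ 1 + ‖d n ω‖ ^ 2 := by nlinarith [sq_nonneg (‖d n ω‖ - 1)]
          have h2 : (√(n : ℝ))⁻¹ * t n * ‖u n ω‖ ≤ t n * (1 + ‖u n ω‖ ^ 2) := by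
            have h3 : ‖u n ω‖ ≤ 1 + ‖u n ω‖ ^ 2 := by nlinarith [sq_nonneg (‖u n ω‖ - 1)]
            have h4 : (√(n : ℝ))⁻¹ * t n ≤ t n :=
              mul_le_of_le_one_left (ht0 n) (inv_le_one_of_one_le₀ hsq1)
            have := ht0 n
            gcongr
          have h5 : ‖u n ω‖ * ‖d n ω‖ ≤ ‖u n ω‖ ^ 2 + ‖d n ω‖ ^ 2 := by
            nlinarith [sq_nonneg (‖u n ω‖ - ‖d n ω‖), sq_nonneg (‖u n ω‖), sq_nonneg (‖d n ω‖)]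
          gcongr
  · refine squeeze_zero (g := fun n : ℕ => (‖ρ‖ * t n * Cg + ‖ρ‖ * c n * (2 / l) * (1 + Cd))
      + (t n * (1 + Cu) + 2 / l * (√(n : ℝ))⁻¹ * (Cu + Cd))) (fun n => integral_nonneg fun ω => ?_)
      (fun n => ?_) ?_
    · have := ht0 n
      have := (hreg.threshold_pos n).le
      have : 0 ≤ g n ω := by positivity
      positivity
    · have h1 := ht0 n
      have h2 := (hreg.threshold_pos n).le
      have e1 : ∫ ω, ‖ρ‖ * t n * g n ω ∂P = ‖ρ‖ * t n * ∫ ω, g n ω ∂P := integral_const_mul _ _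
      have e2 : ∫ ω, ‖ρ‖ * c n * (2 / l) * (1 + ‖d n ω‖ ^ 2) ∂P
          = ‖ρ‖ * c n * (2 / l) * (∫ _, (1 : ℝ) ∂P + ∫ ω, ‖d n ω‖ ^ 2 ∂P) := by
        rw [integral_const_mul, integral_add (integrable_const 1) (hd n).1]
      have e3 : ∫ ω, t n * (1 + ‖u n ω‖ ^ 2) ∂P
          = t n * (∫ _, (1 : ℝ) ∂P + ∫ ω, ‖u n ω‖ ^ 2 ∂P) := by
        rw [integral_const_mul, integral_add (integrable_const 1) (hu n).1]
      have e4 : ∫ ω, 2 / l * (√(n : ℝ))⁻¹ * (‖u n ω‖ ^ 2 + ‖d n ω‖ ^ 2) ∂P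
          = 2 / l * (√(n : ℝ))⁻¹ * (∫ ω, ‖u n ω‖ ^ 2 ∂P + ∫ ω, ‖d n ω‖ ^ 2 ∂P) := by
        rw [integral_const_mul, integral_add (hu n).1 (hd n).1]
      rw [integral_add (hint12 n) (hint34 n), integral_add (hint1 n) (hint2 n),
        integral_add (hint3 n) (hint4 n), e1, e2, e3, e4]
      have hone : ∫ _ : Ω, (1 : ℝ) ∂P = 1 := by simp
      rw [hone]
      have hdn : ∫ ω, ‖d n ω‖ ^ 2 ∂P ≤ Cd := (hd n).2
      have hun : ∫ ω, ‖u n ω‖ ^ 2 ∂P ≤ Cu := (hu n).2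
      have hgn : ∫ ω, g n ω ∂P ≤ Cg := (hg n).2
      gcongr
    · have h1 := (ht.const_mul ‖ρ‖).mul_const Cg
      have h2 := ((hreg.threshold_tendsto.const_mul ‖ρ‖).mul_const (2 / l)).mul_const (1 + Cd)
      have h3 := ht.mul_const (1 + Cu)
      have h4 := (tendsto_inv_sqrt_natCast_atTop.const_mul (2 / l)).mul_const (Cu + Cd)
      simpa using (h1.add h2).add (h3.add h4)

end Remainder

theorem MeasureTheory.TendstoInMeasure.mul_zero_of_abs_le {Ω : Type*} [MeasurableSpace Ω]
    {P : Measure Ω} {r : ℕ → Ω → ℝ} {β : ℕ → ℝ} {M : ℝ}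
    (hr : TendstoInMeasure P r atTop 0) (hβ : ∀ᶠ n in atTop, |β n| ≤ M) :
    TendstoInMeasure P (fun n ω => β n * r n ω) atTop 0 := by
  rw [tendstoInMeasure_iff_norm] at hr ⊢
  intro δ hδ
  have hM : 0 < |M| + 1 := by positivity
  refine tendsto_of_tendsto_of_tendsto_of_le_of_le' (g := fun _ => 0) tendsto_const_nhds
    (hr (δ / (|M| + 1)) (by positivity)) (Eventually.of_forall fun _ => zero_le) ?_
  filter_upwards [hβ] with n hn
  refine measure_mono fun ω hω => ?_
  simp only [Set.mem_ofPred_eq, Pi.zero_apply, sub_zero, norm_mul] at hω ⊢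
  rw [div_le_iff₀' hM]
  refine hω.trans (mul_le_mul_of_nonneg_right ?_ (norm_nonneg _))
  rw [Real.norm_eq_abs]
  linarith [le_abs_self M]

/-! ### Slutsky arguments and comparison of limit laws. -/

section ConvergenceInDistribution

variable {Ω Ω' Ω'' : Type*} [MeasurableSpace Ω] [MeasurableSpace Ω'] [MeasurableSpace Ω'']
  {P : Measure Ω} [IsProbabilityMeasure P] {P' : Measure Ω'} [IsProbabilityMeasure P']
  {P'' : Measure Ω''} [IsProbabilityMeasure P'']

theorem MeasureTheory.TendstoInDistribution.comp_tendsto {E : Type*} [TopologicalSpace E]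
    [MeasurableSpace E] [OpensMeasurableSpace E] {U : ℕ → Ω → E} {ζ : Ω' → E}
    (h : TendstoInDistribution U atTop ζ (fun _ => P) P') {φ : ℕ → ℕ}
    (hφ : Tendsto φ atTop atTop) :
    TendstoInDistribution (fun k => U (φ k)) atTop ζ (fun _ => P) P' :=
  ⟨fun k => h.forall_aemeasurable (φ k), h.aemeasurable_limit, h.tendsto.comp hφ⟩

/-- If `W n = β n * U n + s n` with `β n → b` and `s n → 0` in measure, and `U n`, `W n` converge in
distribution to `ξ`, `ζ`, then `ζ` has the law of `b * ξ`. -/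
theorem map_eq_map_const_mul_of_tendstoInDistribution {U W s : ℕ → Ω → ℝ} {β : ℕ → ℝ} {b : ℝ}
    {ξ : Ω' → ℝ} {ζ : Ω'' → ℝ} (hU : TendstoInDistribution U atTop ξ (fun _ => P) P')
    (hW : TendstoInDistribution W atTop ζ (fun _ => P) P'') (hβ : Tendsto β atTop (𝓝 b))
    (hs : TendstoInMeasure P s atTop 0)
    (hWU : ∀ᶠ n in atTop, ∀ ω, W n ω = β n * U n ω + s n ω) :
    P''.map ζ = P'.map fun ω => b * ξ ω := by
  have hβ' : TendstoInMeasure P (fun n (_ : Ω) => β n) atTop fun _ => b :=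
    tendstoInMeasure_of_tendsto_ae (fun _ => aestronglyMeasurable_const) (ae_of_all _ fun _ => hβ)
  have h1 : TendstoInDistribution (fun n ω => β n * U n ω) atTop (fun ω => b * ξ ω)
      (fun _ => P) P' :=
    hU.continuous_comp_prodMk_of_tendstoInMeasure_const (g := fun p : ℝ × ℝ => p.2 * p.1)
      (by fun_prop) hβ' fun _ => aemeasurable_const
  have h2 : TendstoInMeasure P (W - fun n ω => β n * U n ω) atTop 0 := by
    refine hs.congr' (hWU.mono fun n hn => ae_of_all _ fun ω => ?_) (ae_eq_refl _)
    simp [hn ω]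
  have h3 := tendstoInDistribution_of_tendstoInMeasure_sub W _ h1 h2 hW.forall_aemeasurable
  exact tendstoInDistribution_unique W hW h3

end ConvergenceInDistribution

/-- A random element of a Hilbert space cannot have centered Gaussian marginals with variances
bounded away from zero along an orthonormal sequence. -/
theorem not_forall_map_inner_eq_gaussianReal {Ω H : Type*} [MeasurableSpace Ω]
    [NormedAddCommGroup H] [InnerProductSpace ℝ H] [MeasurableSpace H] [BorelSpace H]
    {P : Measure Ω} [IsProbabilityMeasure P] {Z : Ω → H} (hZ : AEMeasurable Z P) {e : ℕ → H}
    (he : Orthonormal ℝ e) {v : ℕ → NNReal} {v₀ : ℝ} (hv₀ : 0 < v₀) (hv : ∀ j, v₀ ≤ v j) :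
    ¬ ∀ j, P.map (fun ω => ⟪Z ω, e j⟫) = gaussianReal 0 (v j) := by
  intro h
  have hm : ∀ j, AEMeasurable (fun ω => ⟪Z ω, e j⟫) P := fun j =>
    (by fun_prop : Continuous fun z : H => ⟪z, e j⟫).measurable.comp_aemeasurable hZ
  -- Bessel's inequality makes the squared coordinates summable.
  have hlim : ∀ z : H, Tendsto (fun j => ⟪z, e j⟫) atTop (𝓝 0) := fun z => by
    have h1 := (he.inner_products_summable (x := z)).tendsto_atTop_zero
    have h2 := (Real.continuous_sqrt.tendsto 0).comp h1
    rw [tendsto_zero_iff_norm_tendsto_zero]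
    simpa [Function.comp_def, Real.sqrt_sq_eq_abs, real_inner_comm] using h2
  -- The characteristic function at `1` equals `exp (-v j / 2)`, at most `exp (-v₀ / 2) < 1`,
  -- whereas dominated convergence sends it to `1`.
  have hexp : ∀ j, ∫ ω, Complex.exp (⟪Z ω, e j⟫ * Complex.I) ∂P
      = Complex.exp (-((v j : ℝ) : ℂ) / 2) := fun j => by
    have h1 : charFun (P.map fun ω => ⟪Z ω, e j⟫) 1 = charFun (gaussianReal 0 (v j)) 1 := by
      rw [h j]
    rw [charFun_apply_real, charFun_gaussianReal, integral_map (hm j) (by fun_prop)] at h1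
    simpa [neg_div] using h1
  have hdct : Tendsto (fun j => ∫ ω, Complex.exp (⟪Z ω, e j⟫ * Complex.I) ∂P) atTop (𝓝 1) := by
    have := tendsto_integral_of_dominated_convergence (μ := P)
      (F := fun j ω => Complex.exp (⟪Z ω, e j⟫ * Complex.I)) (f := fun _ => (1 : ℂ)) (fun _ => 1)
      (fun j => ?_) (integrable_const 1) (fun j => ae_of_all _ fun ω => ?_)
      (ae_of_all _ fun ω => ?_)
    · simpa using this
    · exact ((by fun_prop : Continuous fun x : ℝ => Complex.exp (x * Complex.I)).measurable
        |>.comp_aemeasurable (hm j)).aestronglyMeasurable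
    · rw [Complex.norm_exp_ofReal_mul_I]
    · have := ((by fun_prop : Continuous fun x : ℝ => Complex.exp (x * Complex.I)).tendsto 0).comp
        (hlim (Z ω))
      simpa [Function.comp_def] using this
  have hle : (1 : ℝ) ≤ Real.exp (-v₀ / 2) := by
    have h1 : Tendsto (fun j => ‖∫ ω, Complex.exp (⟪Z ω, e j⟫ * Complex.I) ∂P‖) atTop (𝓝 1) := by
      simpa using hdct.norm
    refine le_of_tendsto h1 (Eventually.of_forall fun j => ?_)
    rw [hexp j, Complex.norm_exp, Real.exp_le_exp]
    have := hv j
    have h2 : (-((v j : ℝ) : ℂ) / 2).re = -(v j : ℝ) / 2 := by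
      rw [show (-((v j : ℝ) : ℂ) / 2) = ((-(v j : ℝ) / 2 : ℝ) : ℂ) by push_cast; ring,
        Complex.ofReal_re]
    rw [h2]
    linarith
  linarith [Real.one_le_exp_iff.1 hle]

/-! ### The dichotomy on `α n / √n`. -/

theorem theorem1 {Ω Ω' H : Type*} [MeasurableSpace Ω] [MeasurableSpace Ω']
    [NormedAddCommGroup H] [InnerProductSpace ℝ H] [CompleteSpace H]
    [TopologicalSpace.SeparableSpace H] [MeasurableSpace H] [BorelSpace H]
    (P : Measure Ω) [IsProbabilityMeasure P] (P' : Measure Ω') [IsProbabilityMeasure P']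
    (X : Ω → H) (Y : Ω → ℝ) (ρ : H) (σ : ℝ) (hσ : 0 < σ)
    (hmodel : IsFunctionalLinearModel P X Y ρ σ)
    (lam : ℕ → ℝ) (e : ℕ → H)
    (hspec : IsSimpleSpectrum (covarianceOperator (P.map X)) lam e)
    (Xs : ℕ → Ω → H) (Ys : ℕ → Ω → ℝ) (hsample : IsIIDSample P X Y Xs Ys)
    (c : ℕ → ℝ) (f : ℕ → ℝ → ℝ) (hreg : IsRegularization (lam 0) (lam 1) c f)
    (α : ℕ → ℝ) (Z : Ω' → H)
    (hZ : TendstoInDistribution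
      (fun n ω => α n • (regEstimator (f n) (fun i => Xs i ω) (fun i => Ys i ω) n - ρ))
      atTop Z (fun _ => P) P') :
    ∃ h : H, ∀ᵐ ω' ∂P', Z ω' = h := by
  have : SecondCountableTopology H := UniformSpace.secondCountable_of_separable H
  have hPX : IsProbabilityMeasure (P.map X) :=
    Measure.isProbabilityMeasure_map hmodel.measurable_X.aemeasurable
  set β : ℕ → ℝ := fun n => α n / √(n : ℝ) with hβ
  set G := covarianceOperator (P.map X) with hG
  set A : ℕ → ℕ → Ω → ℝ := fun j n ω =>
    ⟪α n • (regEstimator (f n) (fun i => Xs i ω) (fun i => Ys i ω) n - ρ),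
      empCov (fun i => Xs i ω) n (e j)⟫ with hA_def
  set C : ℕ → ℕ → Ω → ℝ := fun j n ω =>
    √(n : ℝ) * ⟪empNoise ρ (fun i => Xs i ω) (fun i => Ys i ω) n, e j⟫ with hC_def
  set r : ℕ → ℕ → Ω → ℝ := fun j n ω => √(n : ℝ) *
    (⟪regEstimator (f n) (fun i => Xs i ω) (fun i => Ys i ω) n - ρ,
      empCov (fun i => Xs i ω) n (e j)⟫
      - ⟪empNoise ρ (fun i => Xs i ω) (fun i => Ys i ω) n, e j⟫) with hr_def
  set v : ℕ → NNReal := fun j => (σ ^ 2 * lam j).toNNReal with hv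
  have hvpos : ∀ j, 0 < σ ^ 2 * lam j := fun j => mul_pos (by positivity) (hspec.pos j)
  -- Norm-topology convergence is essential here: the test vectors `Γ_n e_j` are random, and Slutsky
  -- needs the inner product to be jointly continuous.
  have hA : ∀ j, TendstoInDistribution (A j) atTop (fun ω' => ⟪Z ω', G (e j)⟫) (fun _ => P) P' :=
    fun j => hZ.continuous_comp_prodMk_of_tendstoInMeasure_const (g := fun p : H × H => ⟪p.1, p.2⟫)
      (by fun_prop) (tendstoInMeasure_empCov_apply hmodel hsample (e j))
      fun n => (measurable_empCov_apply hsample (e j) n).aemeasurable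
  have hC : ∀ j, TendstoInDistribution (C j) atTop id (fun _ => P) (gaussianReal 0 (v j)) :=
    fun j => by
      have h1 : ⟪G (e j), e j⟫ = lam j := by
        rw [hspec.eigen, real_inner_smul_left, real_inner_self_eq_norm_sq, hspec.orthonormal.1]
        simp
      simpa only [hv, ← h1] using
        tendstoInDistribution_sqrt_mul_inner_empNoise hmodel hsample (e j)
  have hr : ∀ j, TendstoInMeasure P (r j) atTop 0 := fun j =>
    tendstoInMeasure_sqrt_mul_inner_regEstimator_sub hmodel hsample (hspec.pos j) (hspec.eigen j)
      (hspec.orthonormal.1 j) hreg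
  have hACr : ∀ j n, 0 < n → ∀ ω, A j n ω = β n * (C j n ω + r j n ω) := fun j n hn ω => by
    have hsq : √(n : ℝ) ≠ 0 := by positivity
    simp only [hA_def, hC_def, hr_def, hβ, real_inner_smul_left]
    field_simp
    ring
  -- Failure of this condition means exactly `|β n| → ∞`.
  by_cases hbdd : ∃ M, ∃ᶠ n in atTop, |β n| ≤ M
  · obtain ⟨M, hM⟩ := hbdd
    obtain ⟨b, -, φ, hφ, hb⟩ := tendsto_subseq_of_frequently_bounded
      (Metric.isBounded_closedBall (x := (0 : ℝ)) (r := M)) (x := β)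
      (hM.mono fun n hn => by simpa using hn)
    have hφ' := hφ.tendsto_atTop
    -- The variable `λ_j ⟪Z, e_j⟫` has the law of `b` times `N(0, σ² λ_j)`; dividing by `λ_j` puts
    -- `λ_j` in the denominator of the variance.
    have hlaw : ∀ j, P'.map (fun ω' => ⟪Z ω', e j⟫)
        = gaussianReal 0 (Real.toNNReal (b ^ 2 * σ ^ 2 / lam j)) := fun j => by
      have hl := hspec.pos j
      have h1 := map_eq_map_const_mul_of_tendstoInDistribution ((hC j).comp_tendsto hφ')
        ((hA j).comp_tendsto hφ') hb
        (s := fun k ω => β (φ k) * r j (φ k) ω)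
        (((hr j).comp hφ').mul_zero_of_abs_le (M := |b| + 1)
          (hb.abs.eventually_le_const (by linarith)))
        ((hφ'.eventually_gt_atTop 0).mono fun k hk ω => by
          rw [hACr j _ hk, mul_add]; rfl)
      have hmZ : AEMeasurable (fun ω' => ⟪Z ω', G (e j)⟫) P' := (hA j).aemeasurable_limit
      have h2 : (fun ω' => ⟪Z ω', e j⟫) = (fun x => (lam j)⁻¹ * x) ∘ fun ω' => ⟪Z ω', G (e j)⟫ := by
        ext ω'
        simp only [Function.comp, hspec.eigen, real_inner_smul_right]
        field_simp
      rw [h2, ← AEMeasurable.map_map_of_aemeasurable (by fun_prop) hmZ, h1]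
      simp only [id]
      rw [gaussianReal_map_const_mul, gaussianReal_map_const_mul]
      congr 1
      · simp
      · ext
        simp only [NNReal.coe_mul, NNReal.coe_mk, hv, Real.coe_toNNReal _ (hvpos j).le,
          Real.coe_toNNReal _ (div_nonneg (mul_nonneg (sq_nonneg b) (sq_nonneg σ)) hl.le)]
        field_simp
    by_cases hb0 : b = 0
    · refine ⟨0, ?_⟩
      have hzero : ∀ j, ∀ᵐ ω' ∂P', ⟪e j, Z ω'⟫ = 0 := fun j => by
        have hm : AEMeasurable (fun ω' => ⟪Z ω', e j⟫) P' :=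
          (by fun_prop : Continuous fun z : H => ⟪z, e j⟫).measurable.comp_aemeasurable
            hZ.aemeasurable_limit
        have h1 : ∀ᵐ x ∂(P'.map fun ω' => ⟪Z ω', e j⟫), x = 0 := by
          rw [hlaw j, hb0]
          simp [ae_dirac_eq]
        filter_upwards [ae_of_ae_map hm h1] with ω' hω'
        rw [real_inner_comm, hω']
      filter_upwards [ae_all_iff.2 hzero] with ω' hω'
      exact hspec.eq_zero_of_forall_inner_eq_zero
        (isCompactOperator_covarianceOperator hmodel.memLp_id_map)
        isPositive_covarianceOperator.isSymmetric hmodel.ker_cov hω'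
    -- As `lam` decreases, the variances increase with `j`, so the one at `j = 0` is a lower bound.
    · refine absurd hlaw (not_forall_map_inner_eq_gaussianReal hZ.aemeasurable_limit
        hspec.orthonormal (v₀ := b ^ 2 * σ ^ 2 / lam 0) ?_ fun j => ?_)
      · have := hspec.pos 0
        positivity
      · have hl := hspec.pos j
        rw [Real.coe_toNNReal _ (by positivity)]
        gcongr
        exact hspec.strictAnti.antitone (Nat.zero_le j)
  · exfalso
    push Not at hbdd
    have habs : Tendsto (fun n => |β n|) atTop atTop :=
      tendsto_atTop.2 fun M => (hbdd M).mono fun n hn => hn.le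
    have hinv : Tendsto (fun n => (β n)⁻¹) atTop (𝓝 0) := by
      rw [tendsto_zero_iff_abs_tendsto_zero]
      simpa [Function.comp_def, abs_inv] using tendsto_inv_atTop_zero.comp habs
    -- The roles are exchanged: `C = β⁻¹ A - r` with `β⁻¹ → 0`, so the Gaussian limit of `C` would
    -- be a point mass at `0`.
    have h1 := map_eq_map_const_mul_of_tendstoInDistribution (hA 0) (hC 0) hinv
      (s := fun n ω => -1 * r 0 n ω) ((hr 0).mul_zero_of_abs_le (β := fun _ => -1) (M := 1)
        (Eventually.of_forall fun _ => by simp))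
      (by
        filter_upwards [hbdd 0, eventually_gt_atTop 0] with n hn hn0 ω
        rw [hACr 0 n hn0, inv_mul_cancel_left₀ (abs_pos.1 hn)]
        ring)
    have hv0 : v 0 ≠ 0 := by simpa [hv] using hvpos 0
    have := nullSingletonClass_gaussianReal (μ := 0) hv0
    simp only [Measure.map_id, zero_mul, Measure.map_const, measure_univ, one_smul] at h1
    have h2 : (gaussianReal 0 (v 0)) {0} = 0 := measure_singleton 0
    rw [h1] at h2
    simp at h2
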